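/- Let $G$ be a finite group. For a finite group $X$ let $Z^2X$ be the group of maps $\alpha:X\times X\to\mathbb C^\times$ with $\alpha(x,y)\alpha(xy,z)=\alpha(x,yz)\alpha(y,z)$, let $B^2X$ be the subgroup of the maps $\delta\zeta(x,y)=\zeta(x)\zeta(y)\zeta(xy)^{-1}$ for $\zeta:X\to\mathbb C^\times$, and let $H^2X=Z^2X/B^2X$. For $c\in H^2X$, a $c$-module of $X$ is a finite-dimensional complex vector space $V$ with a map $\varphi:X\to\mathrm{GL}(V)$ such that $\varphi(x)\varphi(y)=\alpha(x,y)\varphi(xy)$ for some cocycle $\alpha$ of class $c$. It is irreducible if $V\ne0$ and the only $\varphi(X)$-invariant subspaces are $0$ and $V$. The cocycle $\alpha$ being fixed, such a $V$ is a module over the twisted group algebra $\mathbb C^cX$, which has basis $X$ and product $x\cdot y=\alpha(x,y)\,xy$; for $J\le X$ and a $\mathbb C^cJ$-module $U$ (the cocycle being $\alpha|_{J\times J}$), the induced module is $U^{\uparrow^cX}=\mathbb C^cX\otimes_{\mathbb C^cJ}U$. Let $1=N_0\le N_1\le\dots\le N_l=G$ be a series of normal subgroups of $G$, let $c\in H^2G$,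 and let $V$ be an irreducible $c$-module of $G$, with cocycle $\alpha$. Then there are a subgroup $J\le G$ and, for each $i=1,\dots,l$, a coclass $c_i\in H^2(J/(J\cap N_{i-1}))$ and an irreducible $c_i$-module $Y_i$ of $J/(J\cap N_{i-1})$, such that, regarding $Y_i$ as a projective module of $J$ by inflation: (i) the restriction of $Y_i$ to $J\cap N_i$ is irreducible for every $i$; (ii) the product of the inflations of $c_1,\dots,c_l$ to $J$ is the restriction of $c$ to $J$, so that $Y_1\otimes\dots\otimes Y_l$ with the diagonal action of $J$ is a $c|_J$-module; (iii) after multiplying the diagonal action of each $g\in J$ on $Y_1\otimes\dots\otimes Y_l$ by a suitable nonzero scalar, so that its cocycle is $\alpha|_{J\times J}$, there is an isomorphism of $\mathbb C^cG$-modules $V\cong(Y_1\otimes\dots\otimes Y_l)^{\uparrow^cG}$. -/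

import Mathlib

open scoped TensorProduct

universe u v w

/-- The group `Z²G` of two-cocycles of `G` with values in `ℂˣ` (trivial action),
with pointwise multiplication. -/
def SchurCocycle (G : Type u) [Group G] : Subgroup (G → G → ℂˣ) where
  carrier := {α | ∀ x y z, α x y * α (x * y) z = α x (y * z) * α y z}
  mul_mem' := by
    intro α β hα hβ x y z
    simp only [Pi.mul_apply]
    rw [mul_mul_mul_comm, hα, hβ, mul_mul_mul_comm]
  one_mem' := by intro x y z; simp
  inv_mem' := by
    intro α hα x y z
    simp only [Pi.inv_apply]
    rw [← mul_inv, ← mul_inv, hα]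

/-- The coboundary `δζ (x, y) = ζ x * ζ y * (ζ (x * y))⁻¹`. -/
def schurCoboundary (G : Type u) [Group G] : (G → ℂˣ) →* SchurCocycle G where
  toFun ζ := ⟨fun x y => ζ x * ζ y * (ζ (x * y))⁻¹, by
    intro x y z
    simp only [mul_assoc x y z]
    have h1 := mul_inv_cancel (ζ (x * y))
    have h2 := mul_inv_cancel (ζ (y * z))
    calc _ = ζ x * ζ y * ζ z * (ζ (x * (y * z)))⁻¹ * (ζ (x * y) * (ζ (x * y))⁻¹) := by
          ac_rfl
      _ = ζ x * ζ y * ζ z * (ζ (x * (y * z)))⁻¹ * (ζ (y * z) * (ζ (y * z))⁻¹) := by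
          rw [h1, h2]
      _ = _ := by ac_rfl⟩
  map_one' := by ext; simp
  map_mul' ζ ξ := by
    apply Subtype.ext
    funext x y
    simp only [Subgroup.coe_mul, Pi.mul_apply, mul_inv]
    rw [mul_mul_mul_comm (ζ x), mul_mul_mul_comm (ζ x * ζ y)]

/-- The Schur multiplier `H²G = Z²G / B²G`; its elements are the coclasses of `G`. -/
def SchurMultiplier (G : Type u) [Group G] : Type u :=
  SchurCocycle G ⧸ (schurCoboundary G).range

noncomputable instance (G : Type u) [Group G] : CommGroup (SchurMultiplier G) :=
  inferInstanceAs (CommGroup (SchurCocycle G ⧸ (schurCoboundary G).range))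

namespace SchurCocycle

/-- The coclass of a cocycle. -/
def coclass {G : Type u} [Group G] (α : SchurCocycle G) : SchurMultiplier G :=
  (QuotientGroup.mk α : SchurCocycle G ⧸ (schurCoboundary G).range)

/-- Pull-back of cocycles along a group homomorphism. -/
def comap {G : Type u} {H : Type v} [Group G] [Group H] (f : H →* G) :
    SchurCocycle G →* SchurCocycle H where
  toFun α := ⟨fun x y => α.1 (f x) (f y), by
    intro x y z
    simpa using α.2 (f x) (f y) (f z)⟩
  map_one' := rfl
  map_mul' _ _ := rfl

/-- Restriction of a cocycle to a subgroup. -/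
abbrev res {G : Type u} [Group G] (H : Subgroup G) (α : SchurCocycle G) : SchurCocycle H :=
  comap H.subtype α

/-- Inflation of a cocycle of `G ⧸ N` to `G`. -/
abbrev infl {G : Type u} [Group G] (N : Subgroup G) [N.Normal] (α : SchurCocycle (G ⧸ N)) :
    SchurCocycle G :=
  comap (QuotientGroup.mk' N) α

end SchurCocycle

namespace SchurMultiplier

/-- Pull-back of coclasses along a group homomorphism. -/
noncomputable def comap {G : Type u} {H : Type v} [Group G] [Group H] (f : H →* G) :
    SchurMultiplier G →* SchurMultiplier H :=
  QuotientGroup.map (schurCoboundary G).range (schurCoboundary H).range (SchurCocycle.comap f) (by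
    rintro _ ⟨ζ, rfl⟩
    refine ⟨fun x => ζ (f x), ?_⟩
    apply Subtype.ext
    funext x y
    simp [schurCoboundary, SchurCocycle.comap])

/-- Restriction `H²G → H²H` of coclasses to a subgroup `H`. -/
noncomputable abbrev res {G : Type u} [Group G] (H : Subgroup G) : SchurMultiplier G →* SchurMultiplier H :=
  comap H.subtype

/-- Inflation `H²(G/N) → H²G` of coclasses. -/
noncomputable abbrev infl {G : Type u} [Group G] (N : Subgroup G) [N.Normal] :
    SchurMultiplier (G ⧸ N) →* SchurMultiplier G :=
  comap (QuotientGroup.mk' N)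

end SchurMultiplier

/-- A map `φ : G → GL(V)` with cocycle `α`, that is `φ x ∘ φ y = α(x, y) φ (x y)`.
Equivalently, `V` is a module over the twisted group algebra defined by `α`.
With `c` the coclass of `α`, this makes `V` a `c`-module of `G`, and every `c`-module
arises in this way by the choice of a section. -/
structure TwistedRep {G : Type u} [Group G] (α : SchurCocycle G)
    (V : Type v) [AddCommGroup V] [Module ℂ V] where
  toFun : G → V ≃ₗ[ℂ] V
  map_mul : ∀ x y v, toFun x (toFun y v) = (α.1 x y : ℂ) • toFun (x * y) v

namespace TwistedRep

section basic

variable {G : Type u} [Group G] {α : SchurCocycle G}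
  {V : Type v} [AddCommGroup V] [Module ℂ V]

/-- `V` is irreducible: it is nonzero and its only submodules are `0` and `V`. -/
def IsIrreducible (φ : TwistedRep α V) : Prop :=
  Nontrivial V ∧
    ∀ W : Submodule ℂ V, (∀ g, ∀ w ∈ W, φ.toFun g w ∈ W) → W = ⊥ ∨ W = ⊤

/-- Similarity (isomorphism) of two modules with the same cocycle. -/
def IsSimilar {V' : Type w} [AddCommGroup V'] [Module ℂ V']
    (φ : TwistedRep α V) (φ' : TwistedRep α V') : Prop :=
  ∃ e : V ≃ₗ[ℂ] V', ∀ g v, e (φ.toFun g v) = φ'.toFun g (e v)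

/-- `φ` and `φ'` are sections of the same projective representation `G → PGL(V)`:
they differ by a scalar at each element of `G`. -/
def SameProjective {α' : SchurCocycle G} (φ : TwistedRep α V) (φ' : TwistedRep α' V) : Prop :=
  ∀ g, ∃ z : ℂˣ, ∀ v, φ.toFun g v = (z : ℂ) • φ'.toFun g v

/-- Pull-back along a group homomorphism. -/
def comap {H : Type w} [Group H] (f : H →* G) (φ : TwistedRep α V) :
    TwistedRep (SchurCocycle.comap f α) V where
  toFun h := φ.toFun (f h)
  map_mul x y v := by
    rw [f.map_mul]
    exact φ.map_mul (f x) (f y) v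

/-- Restriction to a subgroup. -/
abbrev res (H : Subgroup G) (φ : TwistedRep α V) : TwistedRep (SchurCocycle.res H α) V :=
  comap H.subtype φ

/-- Inflation from `G ⧸ N` to `G`. -/
abbrev infl (N : Subgroup G) [N.Normal] {β : SchurCocycle (G ⧸ N)} (φ : TwistedRep β V) :
    TwistedRep (SchurCocycle.infl N β) V :=
  comap (QuotientGroup.mk' N) φ

end basic

/-- The tensor product of a finite family, with the diagonal action
`g ↦ φ₁ g ⊗ ⋯ ⊗ φₗ g`; its cocycle is the product of the cocycles. -/
noncomputable def tensor {G : Type u} [Group G] {ι : Type w} [Fintype ι] {γ : ι → SchurCocycle G}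
    {Y : ι → Type v} [∀ i, AddCommGroup (Y i)] [∀ i, Module ℂ (Y i)]
    (φ : ∀ i, TwistedRep (γ i) (Y i)) : TwistedRep (∏ i, γ i) (⨂[ℂ] i, Y i) where
  toFun g := PiTensorProduct.congr fun i => (φ i).toFun g
  map_mul x y v := by
    have key : (PiTensorProduct.congr fun i => (φ i).toFun x).toLinearMap ∘ₗ
        (PiTensorProduct.congr fun i => (φ i).toFun y).toLinearMap =
        (((∏ i, γ i : SchurCocycle G).1 x y : ℂˣ) : ℂ) •
          (PiTensorProduct.congr fun i => (φ i).toFun (x * y)).toLinearMap := by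
      apply PiTensorProduct.ext
      ext m
      have h : (((∏ i, γ i : SchurCocycle G).1 x y : ℂˣ) : ℂ) =
          ∏ i, (((γ i).1 x y : ℂˣ) : ℂ) := by
        simp [Finset.prod_apply]
      simp only [LinearMap.compMultilinearMap_apply, LinearMap.comp_apply,
        LinearEquiv.coe_coe, PiTensorProduct.congr_tprod, LinearMap.smul_apply,
        (φ _).map_mul, h]
      exact MultilinearMap.map_smul_univ _ _ _
    exact LinearMap.congr_fun key v

section induction

variable {G : Type u} [Group G] (α : SchurCocycle G) (H : Subgroup G)
  {U : Type v} [AddCommGroup U] [Module ℂ U]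

/-- The space `G →₀ U` is the tensor product over `ℂ` of the twisted group algebra (with basis
`g`, and product `g * h = α(g, h) gh`) and `U`, with `single g u` standing for `g ⊗ u`.
This is the subspace spanned by the elements `(g * h) ⊗ u - g ⊗ (h u)` with `h ∈ H`. -/
noncomputable def indRel (φ : TwistedRep (SchurCocycle.res H α) U) : Submodule ℂ (G →₀ U) :=
  Submodule.span ℂ {a | ∃ (g : G) (h : H) (u : U),
    a = (α.1 g h : ℂ) • Finsupp.single (g * h) u - Finsupp.single g (φ.toFun h u)}

/-- The induced module, the tensor product over the twisted group algebra of `H` of the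
twisted group algebra of `G` and `U`. -/
abbrev IndSpace (φ : TwistedRep (SchurCocycle.res H α) U) : Type (max u v) :=
  (G →₀ U) ⧸ indRel α H φ

variable (U) in
/-- Left multiplication by `x` on the twisted group algebra tensor `U`:
`x * (g ⊗ u) = α(x, g) (xg ⊗ u)`. -/
noncomputable def preAct (x : G) : (G →₀ U) →ₗ[ℂ] (G →₀ U) :=
  Finsupp.lsum ℂ fun g => (α.1 x g : ℂ) • Finsupp.lsingle (x * g)

variable (U) in
lemma preAct_single (x g : G) (u : U) :
    preAct α U x (Finsupp.single g u) = (α.1 x g : ℂ) • Finsupp.single (x * g) u := by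
  simp [preAct]

variable (U) in
lemma preAct_preAct (x y : G) (a : G →₀ U) :
    preAct α U x (preAct α U y a) = (α.1 x y : ℂ) • preAct α U (x * y) a := by
  induction a using Finsupp.induction_linear with
  | zero => simp
  | add a b ha hb => simp [ha, hb]
  | single g u =>
    have h := congrArg (fun z : ℂˣ => (z : ℂ)) (α.2 x y g)
    simp only [Units.val_mul] at h
    rw [preAct_single, map_smul, preAct_single, preAct_single, smul_smul, smul_smul, h,
      mul_assoc, mul_comm (α.1 y g : ℂ)]

lemma preAct_indRel (φ : TwistedRep (SchurCocycle.res H α) U) (x : G) :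
    indRel α H φ ≤ (indRel α H φ).comap (preAct α U x) := by
  refine Submodule.span_le.2 ?_
  rintro _ ⟨g, h, u, rfl⟩
  have e := congrArg (fun z : ℂˣ => (z : ℂ)) (α.2 x g h)
  simp only [Units.val_mul] at e
  have key : preAct α U x
      ((α.1 g h : ℂ) • Finsupp.single (g * h) u - Finsupp.single g (φ.toFun h u)) =
      (α.1 x g : ℂ) • ((α.1 (x * g) h : ℂ) • Finsupp.single (x * g * h) u -
        Finsupp.single (x * g) (φ.toFun h u)) := by
    rw [map_sub, map_smul, preAct_single, preAct_single, smul_sub, smul_smul, smul_smul, e,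
      mul_assoc x g, mul_comm (α.1 g h : ℂ)]
  change preAct α U x _ ∈ indRel α H φ
  rw [key]
  exact Submodule.smul_mem _ _ (Submodule.subset_span ⟨x * g, h, u, rfl⟩)

/-- The action of `x` on the induced module. -/
noncomputable def indAct (φ : TwistedRep (SchurCocycle.res H α) U) (x : G) :
    IndSpace α H φ →ₗ[ℂ] IndSpace α H φ :=
  (indRel α H φ).mapQ _ (preAct α U x) (preAct_indRel α H φ x)

lemma indAct_indAct (φ : TwistedRep (SchurCocycle.res H α) U) (x y : G) (v : IndSpace α H φ) :
    indAct α H φ x (indAct α H φ y v) = (α.1 x y : ℂ) • indAct α H φ (x * y) v := by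
  induction v using Submodule.Quotient.induction_on with
  | H a =>
    simp only [indAct, Submodule.mapQ_apply, preAct_preAct]
    rfl

lemma indAct_one (φ : TwistedRep (SchurCocycle.res H α) U) (v : IndSpace α H φ) :
    indAct α H φ 1 v = (α.1 1 1 : ℂ) • v := by
  induction v using Submodule.Quotient.induction_on with
  | H a =>
    have h : preAct α U 1 a = (α.1 1 1 : ℂ) • a := by
      induction a using Finsupp.induction_linear with
      | zero => simp
      | add a b ha hb => simp [ha, hb]
      | single g u =>
        have e := α.2 1 1 g
        simp only [one_mul, mul_left_inj] at e
        rw [preAct_single, one_mul, e]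
    simp only [indAct, Submodule.mapQ_apply, h]
    rfl

/-- Induction from `H` to `G` of a module with cocycle `α` restricted to `H`. -/
noncomputable def ind (φ : TwistedRep (SchurCocycle.res H α) U) :
    TwistedRep α (IndSpace α H φ) where
  toFun x := LinearEquiv.ofLinearMap (indAct α H φ x)
    ((((α.1 x x⁻¹ * α.1 1 1)⁻¹ : ℂˣ) : ℂ) • indAct α H φ x⁻¹)
    (by
      refine LinearMap.ext fun v => ?_
      simp only [LinearMap.comp_apply, LinearMap.smul_apply, map_smul, indAct_indAct,
        mul_inv_cancel, indAct_one, smul_smul, LinearMap.id_apply]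
      rw [← Units.val_mul, ← Units.val_mul]
      simp)
    (by
      have e : α.1 x⁻¹ x = α.1 x x⁻¹ := by
        have h1 := α.2 x x⁻¹ x
        have h2 := α.2 1 1 x
        have h3 := α.2 x 1 1
        simp only [one_mul, mul_one, mul_inv_cancel, inv_mul_cancel, mul_left_inj,
          mul_right_inj] at h1 h2 h3
        rw [← h2, h3, mul_comm] at h1
        exact (mul_left_cancel h1).symm
      refine LinearMap.ext fun v => ?_
      simp only [LinearMap.comp_apply, LinearMap.smul_apply, indAct_indAct,
        inv_mul_cancel, indAct_one, smul_smul, LinearMap.id_apply, e]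
      rw [← Units.val_mul, ← Units.val_mul]
      simp)
  map_mul x y v := indAct_indAct α H φ x y v

end induction

end TwistedRep

/-! The proof first descends to a primitive module, then splits it into tensor factors along the
normal series. Scalars do not affect subspaces, so most of the argument uses projective actions
without a chosen cocycle; cocycles are recovered at the end.

Among the nonzero subspaces of `V` that are independent from the sum of their other translates, take
a minimal one, `W`, with stabilizer `J`. Blocks of `W` under `J` are blocks of `V`, so `W` is
primitive for `J`. The translates of `W` over the cosets of `J` are independent, and by
irreducibility they span `V`, so `V` is induced from `W` (`isSimilar_ind`).

Let a primitive module be given and let `A` be the algebra spanned by the action of a normal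
subgroup `N`. The group permutes the `A`-isotypic components, so each component is a block and hence
there is only one. For a simple `A`-submodule `Y`, evaluation then identifies the module with `Y ⊗
Hom_A(Y, V)`. Each group element lifts to an `A`-semilinear automorphism of `Y`, unique up to a
scalar by Schur's lemma, so both factors carry projective actions. `N` is irreducible on the first
and scalar on the second (`IsPrimitive.exists_tensor_equiv`). The second factor is again primitive,
so induction along the series applies to it. The resulting `Y i` is scalar on `N i.castSucc`, hence
comes from the quotient, and is irreducible on `N i.succ`. -/

/-- A projective action of `G` on `V`: linear automorphisms of `V`, multiplicative up to scalars. -/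
structure ProjRep (G : Type u) [Group G] (V : Type v) [AddCommGroup V] [Module ℂ V] where
  toFun : G → V ≃ₗ[ℂ] V
  exists_map_mul : ∀ x y, ∃ z : ℂˣ, ∀ v, toFun x (toFun y v) = (z : ℂ) • toFun (x * y) v

/-! ### Blocks of imprimitivity and primitive modules -/

namespace ProjRep

section basic

variable {G : Type u} [Group G] {V : Type v} [AddCommGroup V] [Module ℂ V]

/-- The elements of `N` act by scalars. -/
def ScalarOn (φ : ProjRep G V) (N : Subgroup G) : Prop :=
  ∀ n ∈ N, ∃ z : ℂˣ, ∀ v, φ.toFun n v = (z : ℂ) • v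

/-- The restriction of the action to `N` is irreducible. -/
def IrreducibleOn (φ : ProjRep G V) (N : Subgroup G) : Prop :=
  Nontrivial V ∧
    ∀ W : Submodule ℂ V, (∀ n ∈ N, ∀ w ∈ W, φ.toFun n w ∈ W) → W = ⊥ ∨ W = ⊤

/-- The image of a subspace under the action of `g`. -/
def translate (φ : ProjRep G V) (g : G) (W : Submodule ℂ V) : Submodule ℂ V :=
  W.map (φ.toFun g : V →ₗ[ℂ] V)

variable (φ : ProjRep G V)

lemma mem_translate_of_mem {g : G} {W : Submodule ℂ V} {w : V} (hw : w ∈ W) :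
    φ.toFun g w ∈ φ.translate g W :=
  Submodule.mem_map_of_mem hw

lemma translate_mul (x y : G) (W : Submodule ℂ V) :
    φ.translate (x * y) W = φ.translate x (φ.translate y W) := by
  obtain ⟨z, hz⟩ := φ.exists_map_mul x y
  apply le_antisymm
  · rintro _ ⟨w, hw, rfl⟩
    refine ⟨φ.toFun y (((z⁻¹ : ℂˣ) : ℂ) • w), ⟨_, W.smul_mem _ hw, rfl⟩, ?_⟩
    simp [hz]
  · rintro _ ⟨_, ⟨w, hw, rfl⟩, rfl⟩
    refine ⟨(z : ℂ) • w, W.smul_mem _ hw, ?_⟩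
    simp [hz]

lemma translate_mono {W W' : Submodule ℂ V} (g : G) (h : W ≤ W') :
    φ.translate g W ≤ φ.translate g W' :=
  Submodule.map_mono h

lemma translate_injective (g : G) : Function.Injective (φ.translate g) :=
  Submodule.map_injective_of_injective (φ.toFun g).injective

lemma translate_one (W : Submodule ℂ V) : φ.translate 1 W = W :=
  φ.translate_injective 1 (by rw [← translate_mul, one_mul])

lemma translate_iSup {ι : Sort*} (g : G) (f : ι → Submodule ℂ V) :
    φ.translate g (⨆ i, f i) = ⨆ i, φ.translate g (f i) :=
  Submodule.map_iSup _ _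

lemma translate_disjoint (g : G) {W W' : Submodule ℂ V} (h : Disjoint W W') :
    Disjoint (φ.translate g W) (φ.translate g W') := by
  rw [disjoint_iff] at h ⊢
  rw [translate, translate, ← Submodule.map_inf _ (φ.toFun g).injective, h, Submodule.map_bot]

/-- The stabilizer of a subspace. -/
def stabilizer (W : Submodule ℂ V) : Subgroup G where
  carrier := {g | φ.translate g W = W}
  mul_mem' {a b} ha hb := by
    change φ.translate (a * b) W = W
    rw [translate_mul, show φ.translate b W = W from hb, ha]
  one_mem' := φ.translate_one W
  inv_mem' {a} ha := by
    change φ.translate a⁻¹ W = W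
    apply φ.translate_injective a
    rw [← translate_mul, mul_inv_cancel, translate_one, ha]

lemma mem_stabilizer {W : Submodule ℂ V} {g : G} :
    g ∈ φ.stabilizer W ↔ φ.translate g W = W := Iff.rfl

/-- A block of imprimitivity: a subspace that meets trivially the sum of its other translates. -/
def IsBlock (W : Submodule ℂ V) : Prop :=
  Disjoint W (⨆ g, ⨆ (_ : φ.translate g W ≠ W), φ.translate g W)

/-- `V` is nonzero and has no blocks of imprimitivity but `0` and `V`. -/
def IsPrimitive : Prop :=
  Nontrivial V ∧ ∀ W, W ≠ ⊥ → φ.IsBlock W → W = ⊤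

variable {φ} in
-- An invariant subspace has no other translates, so it is trivially a block: primitivity includes
-- irreducibility.
lemma IsPrimitive.eq_top_of_invariant (h : φ.IsPrimitive) {W : Submodule ℂ V} (hW : W ≠ ⊥)
    (hinv : ∀ g, φ.translate g W = W) : W = ⊤ := by
  refine h.2 W hW ?_
  simp [IsBlock, hinv]

/-- The action of a subgroup that stabilizes the subspace `W` on `W`. -/
noncomputable def subrep (H : Subgroup G) (W : Submodule ℂ V) (h : H ≤ φ.stabilizer W) :
    ProjRep H W where
  toFun g := ((φ.toFun g).submoduleMap W).trans (LinearEquiv.ofEq _ _ (h g.2))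
  exists_map_mul x y := by
    obtain ⟨z, hz⟩ := φ.exists_map_mul x y
    exact ⟨z, fun v => Subtype.ext (hz v)⟩

@[simp] lemma coe_subrep (H : Subgroup G) (W : Submodule ℂ V) (h : H ≤ φ.stabilizer W) (g : H)
    (w : W) : (((φ.subrep H W h).toFun g w : W) : V) = φ.toFun g w := rfl

lemma map_translate_subrep (H : Subgroup G) (W : Submodule ℂ V) (h : H ≤ φ.stabilizer W) (g : H)
    (U : Submodule ℂ W) : ((φ.subrep H W h).translate g U).map W.subtype =
      φ.translate g (U.map W.subtype) := by
  apply le_antisymm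
  · rintro _ ⟨_, ⟨u, hu, rfl⟩, rfl⟩
    exact ⟨u, ⟨u, hu, rfl⟩, rfl⟩
  · rintro _ ⟨_, ⟨u, hu, rfl⟩, rfl⟩
    exact ⟨_, ⟨u, hu, rfl⟩, rfl⟩

variable {φ} in
-- Being a block is transitive; this makes a minimal block primitive for its stabilizer.
lemma IsBlock.of_subrep {W : Submodule ℂ V} (hW : φ.IsBlock W) {U : Submodule ℂ W}
    (hU : (φ.subrep _ W le_rfl).IsBlock U) : φ.IsBlock (U.map W.subtype) := by
  set U' := U.map W.subtype with hU'
  have hle : U' ≤ W := Submodule.map_subtype_le W U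
  set A := ((⨆ g, ⨆ (_ : (φ.subrep _ W le_rfl).translate g U ≠ U),
    (φ.subrep _ W le_rfl).translate g U)).map W.subtype with hA
  have h1 : Disjoint U' A := by
    have := disjoint_iff.1 hU
    rw [disjoint_iff, hU', hA, ← Submodule.map_inf _ W.subtype_injective, this, Submodule.map_bot]
  have h2 : U' ⊔ A ≤ W := sup_le hle (Submodule.map_subtype_le W _)
  -- A translate of `U'` by an element stabilizing `W` lies in `A`; any other lies in a different
  -- translate of `W`. The first kind is independent of `U'` inside `W`, and the second is
  -- independent of `W` as a whole.
  refine (h1.disjoint_sup_right_of_disjoint_sup_left (hW.mono_left h2)).mono_right ?_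
  refine iSup₂_le fun g hg => ?_
  by_cases hgW : φ.translate g W = W
  · refine le_sup_of_le_left ?_
    have e := φ.map_translate_subrep _ W le_rfl ⟨g, hgW⟩ U
    rw [← hU'] at e
    rw [← e, hA]
    apply Submodule.map_mono
    refine le_iSup₂_of_le ⟨g, hgW⟩ (fun h => hg ?_) le_rfl
    rw [← e, h]
  · exact le_sup_of_le_right (le_iSup₂_of_le g hgW (φ.translate_mono g hle))

lemma exists_primitive_block [Nontrivial V] [FiniteDimensional ℂ V] :
    ∃ W : Submodule ℂ V, W ≠ ⊥ ∧ φ.IsBlock W ∧ (φ.subrep _ W le_rfl).IsPrimitive := by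
  have hne : {W : Submodule ℂ V | W ≠ ⊥ ∧ φ.IsBlock W}.Nonempty := by
    refine ⟨⊤, top_ne_bot, ?_⟩
    have : ∀ g, φ.translate g ⊤ = ⊤ := fun g => by
      rw [translate, Submodule.map_top, LinearEquiv.range]
    simp [IsBlock, this]
  -- The whole space is a nonzero block, so finite dimension provides a minimal one.
  obtain ⟨W, ⟨hW, hb⟩, hmin⟩ := (wellFounded_lt (α := Submodule ℂ V)).has_min _ hne
  refine ⟨W, hW, hb, Submodule.nontrivial_iff_ne_bot.2 hW, fun U hU hUb => ?_⟩
  by_contra hUt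
  refine hmin (U.map W.subtype) ⟨?_, IsBlock.of_subrep hb hUb⟩ ?_
  · rw [Submodule.ne_bot_iff] at hU ⊢
    obtain ⟨u, hu, h0⟩ := hU
    exact ⟨u, ⟨u, hu, rfl⟩, by simpa using h0⟩
  · refine lt_of_le_of_ne (Submodule.map_subtype_le W U) fun h => hUt ?_
    apply Submodule.map_injective_of_injective W.subtype_injective
    rw [h, Submodule.map_subtype_top]

variable {φ} in
lemma IsBlock.iSupIndep {W : Submodule ℂ V} (hW : φ.IsBlock W) :
    iSupIndep fun q : G ⧸ φ.stabilizer W => φ.translate q.out W := by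
  intro q
  -- Translating by the inverse of `q.out` reduces independence at the coset `q` to the block
  -- condition at `W` itself.
  rw [← φ.translate_one (⨆ j, ⨆ _, _), ← mul_inv_cancel q.out, translate_mul]
  refine φ.translate_disjoint _ (hW.mono_right ?_)
  simp only [translate_iSup, ← translate_mul]
  refine iSup₂_le fun r hr => le_iSup₂_of_le _ (fun h => hr ?_) le_rfl
  rw [← r.out_eq, ← q.out_eq]
  exact ((QuotientGroup.eq).2 (φ.mem_stabilizer.2 h)).symm

end basic

end ProjRep

/-! ### Induction from the stabilizer of a block -/

namespace TwistedRep

variable {G : Type u} [Group G] {α : SchurCocycle G} {V : Type v} [AddCommGroup V] [Module ℂ V]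

/-- The projective action underlying a twisted representation. -/
def toProjRep (φ : TwistedRep α V) : ProjRep G V :=
  ⟨φ.toFun, fun x y => ⟨α.1 x y, φ.map_mul x y⟩⟩

/-- Transport of a twisted representation along a linear isomorphism. -/
def transport {U : Type w} [AddCommGroup U] [Module ℂ U] (φ : TwistedRep α V) (e : V ≃ₗ[ℂ] U) :
    TwistedRep α U where
  toFun g := (e.symm.trans (φ.toFun g)).trans e
  map_mul x y v := by simp [φ.map_mul]

section

variable {U : Type w} [AddCommGroup U] [Module ℂ U] (φ : TwistedRep α V) (H : Subgroup G)
  (T : TwistedRep (SchurCocycle.res H α) U) (f : U →ₗ[ℂ] V)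

/-- The map from the induced module that extends an equivariant map by Frobenius reciprocity. -/
noncomputable def indLift (hf : ∀ (h : H) u, f (T.toFun h u) = φ.toFun h (f u)) :
    IndSpace α H T →ₗ[ℂ] V :=
  (indRel α H T).liftQ (Finsupp.lsum ℂ fun g => (φ.toFun g : V →ₗ[ℂ] V) ∘ₗ f) (by
    refine Submodule.span_le.2 ?_
    rintro _ ⟨g, h, u, rfl⟩
    rw [SetLike.mem_coe, LinearMap.mem_ker, map_sub, map_smul]
    simp [hf, φ.map_mul])

lemma indLift_mk_single (hf : ∀ (h : H) u, f (T.toFun h u) = φ.toFun h (f u))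
    (g : G) (u : U) :
    indLift φ H T f hf (Submodule.Quotient.mk (Finsupp.single g u)) = φ.toFun g (f u) := by
  change (Finsupp.single g u).sum (fun g u => φ.toFun g (f u)) = _
  rw [Finsupp.sum_single_index (by simp)]

lemma indLift_toFun (hf : ∀ (h : H) u, f (T.toFun h u) = φ.toFun h (f u))
    (x : G) (a : IndSpace α H T) :
    indLift φ H T f hf ((ind α H T).toFun x a) = φ.toFun x (indLift φ H T f hf a) := by
  induction a using Submodule.Quotient.induction_on with
  | H a =>
    have e : (ind α H T).toFun x (Submodule.Quotient.mk a) =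
      Submodule.Quotient.mk (preAct α U x a) := rfl
    rw [e]
    induction a using Finsupp.induction_linear with
    | zero => simp
    | add a b ha hb => simp only [map_add, Submodule.Quotient.mk_add, ha rfl, hb rfl]
    | single g u =>
      rw [preAct_single, Submodule.Quotient.mk_smul, map_smul, indLift_mk_single,
        indLift_mk_single, φ.map_mul]

lemma mk_single_mul (g : G) (h : H) (u : U) :
    (Submodule.Quotient.mk (Finsupp.single (g * h) u) : IndSpace α H T) =
      Submodule.Quotient.mk (Finsupp.single g ((((α.1 g h)⁻¹ : ℂˣ) : ℂ) • T.toFun h u)) := by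
  have : (α.1 g h : ℂ) • Finsupp.single (g * h) u - Finsupp.single g (T.toFun h u) ∈
      indRel α H T := Submodule.subset_span ⟨g, h, u, rfl⟩
  have h2 := (Submodule.Quotient.eq _).2 this
  rw [← Finsupp.smul_single, Submodule.Quotient.mk_smul, ← h2, Submodule.Quotient.mk_smul,
    smul_smul, ← Units.val_mul]
  simp

/-- Every element of the induced module is a sum over coset representatives. -/
lemma exists_mk_coset_sum (a : IndSpace α H T) : ∃ b : (G ⧸ H) →₀ U,
    Submodule.Quotient.mk (Finsupp.lmapDomain U ℂ Quotient.out b) = a := by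
  induction a using Submodule.Quotient.induction_on with
  | H a =>
    induction a using Finsupp.induction_linear with
    | zero => exact ⟨0, by simp⟩
    | add a b ha hb =>
      obtain ⟨a', ha⟩ := ha
      obtain ⟨b', hb⟩ := hb
      exact ⟨a' + b', by rw [map_add, Submodule.Quotient.mk_add, ha, hb,
        Submodule.Quotient.mk_add]⟩
    | single g u =>
      obtain ⟨h, hh⟩ := QuotientGroup.mk_out_eq_mul H g
      have hg : g = (g : G ⧸ H).out * (h⁻¹ : H) := by rw [hh]; simp
      refine ⟨Finsupp.single (g : G ⧸ H)
        ((((α.1 (g : G ⧸ H).out (h⁻¹ : H))⁻¹ : ℂˣ) : ℂ) • T.toFun h⁻¹ u), ?_⟩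
      rw [Finsupp.lmapDomain_apply, Finsupp.mapDomain_single, ← mk_single_mul, ← hg]

/-- An irreducible twisted representation is induced from the stabilizer of a nonzero block. -/
lemma isSimilar_ind (hf : ∀ (h : H) u, f (T.toFun h u) = φ.toFun h (f u))
    (hφ : φ.IsIrreducible) (hinj : Function.Injective f)
    (hne : LinearMap.range f ≠ ⊥) (hb : φ.toProjRep.IsBlock (LinearMap.range f))
    (hH : H = φ.toProjRep.stabilizer (LinearMap.range f)) : φ.IsSimilar (ind α H T) := by
  set F := indLift φ H T f hf with hF
  have hsurj : LinearMap.range F = ⊤ := by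
    -- The image of the induced module is invariant and contains the range of `f`, so it is
    -- everything.
    refine (hφ.2 (LinearMap.range F) ?_).resolve_left ?_
    · rintro g _ ⟨a, rfl⟩
      exact ⟨_, indLift_toFun φ H T f hf g a⟩
    · intro h0
      apply hne
      rw [LinearMap.range_eq_bot] at h0 ⊢
      ext u
      have h1 := indLift_mk_single φ H T f hf 1 u
      rw [← hF, h0] at h1
      simpa using h1.symm
  have hFinj : Function.Injective F := by
    rw [← LinearMap.ker_eq_bot, LinearMap.ker_eq_bot']
    intro a ha
    obtain ⟨b, rfl⟩ := exists_mk_coset_sum H T a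
    have hsum : b.sum (fun q u => φ.toFun q.out (f u)) = 0 := by
      rw [← ha]
      change _ = (Finsupp.mapDomain Quotient.out b).sum fun g u => φ.toFun g (f u)
      rw [Finsupp.sum_mapDomain_index (by simp) (by simp)]
      rfl
    subst hH
    -- The summands lie in translates of the block over distinct cosets, so a vanishing sum has
    -- vanishing terms.
    have hind := (iSupIndep_iff_finsetSum_eq_zero_imp_eq_zero _).1 hb.iSupIndep b.support
      (fun q => φ.toFun q.out (f (b q))) (fun q _ => ProjRep.mem_translate_of_mem _ ⟨_, rfl⟩) hsum
    have : b = 0 := by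
      ext q
      by_contra hq
      have h0 := hind q (Finsupp.mem_support_iff.2 hq)
      exact hq (hinj (by simpa using h0))
    rw [this]
    simp
  let e := LinearEquiv.ofBijective F (And.intro hFinj (LinearMap.range_eq_top.1 hsurj))
  refine ⟨e.symm, fun g v => ?_⟩
  obtain ⟨a, rfl⟩ := e.surjective v
  rw [e.symm_apply_apply, e.symm_apply_eq]
  exact (indLift_toFun φ H T f hf g a).symm

end

end TwistedRep

/-! ### Automorphisms normalizing an algebra, and homogeneous modules -/

set_option linter.unusedSectionVars false

section normalizer

variable (A : Type w) [Ring A] [Algebra ℂ A] {V : Type v} [AddCommGroup V] [Module ℂ V]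
  [Module A V] [IsScalarTower ℂ A V]

/-- Conjugation by `e` preserves the algebra `A`. -/
def Normalizes (e : V ≃ₗ[ℂ] V) : Prop :=
  (∀ a : A, ∃ b : A, ∀ v : V, e (a • v) = b • e v) ∧
    ∀ a : A, ∃ b : A, ∀ v : V, e.symm (a • v) = b • e.symm v

variable {A}

lemma Normalizes.symm {e : V ≃ₗ[ℂ] V} (he : Normalizes A e) : Normalizes A e.symm :=
  ⟨he.2, he.1⟩

/-- The image of an `A`-submodule under an automorphism that normalizes `A`. -/
def Normalizes.twist {e : V ≃ₗ[ℂ] V} (he : Normalizes A e) (S : Submodule A V) :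
    Submodule A V where
  toAddSubmonoid := ((S.restrictScalars ℂ).map (e : V →ₗ[ℂ] V)).toAddSubmonoid
  smul_mem' := by
    rintro a _ ⟨s, hs, rfl⟩
    obtain ⟨b, hb⟩ := he.2 a
    refine ⟨b • s, S.smul_mem b hs, ?_⟩
    have := hb (e s)
    rw [e.symm_apply_apply] at this
    simp only [LinearEquiv.coe_coe]
    rw [← this, e.apply_symm_apply]

variable {e : V ≃ₗ[ℂ] V} (he : Normalizes A e)

lemma Normalizes.mem_twist {S : Submodule A V} {v : V} : v ∈ he.twist S ↔ e.symm v ∈ S := by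
  constructor
  · rintro ⟨s, hs, rfl⟩
    simpa using hs
  · intro h
    exact ⟨_, h, by simp⟩

lemma Normalizes.twist_symm_twist (S : Submodule A V) : he.symm.twist (he.twist S) = S := by
  ext v
  simp [mem_twist]

lemma Normalizes.twist_twist_symm (S : Submodule A V) : he.twist (he.symm.twist S) = S :=
  he.symm.twist_symm_twist S

/-- The automorphism of the lattice of `A`-submodules induced by a normalizing automorphism. -/
def Normalizes.twistIso : Submodule A V ≃o Submodule A V where
  toFun := he.twist
  invFun := he.symm.twist
  left_inv := he.twist_symm_twist
  right_inv := he.twist_twist_symm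
  map_rel_iff' {S T} := by
    constructor
    · intro h v hv
      have := h (he.mem_twist.2 (show e.symm (e v) ∈ S by simpa using hv))
      simpa [mem_twist] using this
    · intro h v hv
      exact he.mem_twist.2 (h (he.mem_twist.1 hv))

lemma Normalizes.isSimpleModule_twist (S : Submodule A V) [IsSimpleModule A S] :
    IsSimpleModule A (he.twist S) := by
  rw [isSimpleModule_iff_isAtom]
  exact (he.twistIso.isAtom_iff S).2 (isSimpleModule_iff_isAtom.1 ‹_›)

/-- The restriction of a normalizing automorphism to a submodule. -/
def Normalizes.twistEquiv (S : Submodule A V) : S ≃ₗ[ℂ] he.twist S :=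
  e.submoduleMap (S.restrictScalars ℂ)

lemma Normalizes.twistEquiv_smul {S : Submodule A V} {a b : A}
    (h : ∀ v : V, e (a • v) = b • e v) (s : S) :
    he.twistEquiv S (a • s) = b • he.twistEquiv S s :=
  Subtype.ext (h s)

lemma Normalizes.exists_smul_eq (he : Normalizes A e) (a : A) :
    ∃ b : A, ∀ v : V, e (b • v) = a • e v := by
  obtain ⟨b, hb⟩ := he.2 a
  exact ⟨b, fun v => by rw [← e.eq_symm_apply, hb, e.symm_apply_apply]⟩

/-- The linear map between twisted submodules induced by a linear map of submodules. -/
def Normalizes.twistMap {S T : Submodule A V} (f : S →ₗ[A] T) : he.twist S →ₗ[A] he.twist T where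
  toFun x := he.twistEquiv T (f ((he.twistEquiv S).symm x))
  map_add' x y := by simp
  map_smul' a x := by
    obtain ⟨b, hb⟩ := he.exists_smul_eq a
    obtain ⟨x, rfl⟩ := (he.twistEquiv S).surjective x
    rw [← he.twistEquiv_smul hb, LinearEquiv.symm_apply_apply, map_smul, he.twistEquiv_smul hb,
      LinearEquiv.symm_apply_apply, RingHom.id_apply]

lemma Normalizes.nonempty_twist_equiv {S T : Submodule A V} (f : S ≃ₗ[A] T) :
    Nonempty (he.twist S ≃ₗ[A] he.twist T) :=
  ⟨LinearEquiv.ofLinearMap (he.twistMap f) (he.twistMap f.symm)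
    (by ext x; simp [twistMap]) (by ext x; simp [twistMap])⟩

lemma Normalizes.twist_isotypicComponent_le (S : Submodule A V) :
    he.twist (isotypicComponent A V S) ≤ isotypicComponent A V (he.twist S) := by
  change he.twistIso _ ≤ _
  rw [isotypicComponent, OrderIso.map_sSup]
  refine iSup₂_le fun m ⟨f⟩ => le_sSup (he.nonempty_twist_equiv f)

/-- The reverse inclusion is the first one applied to the inverse automorphism. -/
lemma Normalizes.twist_isotypicComponent (S : Submodule A V) :
    he.twist (isotypicComponent A V S) = isotypicComponent A V (he.twist S) := by
  refine le_antisymm (he.twist_isotypicComponent_le S) ?_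
  have h := he.symm.twist_isotypicComponent_le (he.twist S)
  rw [he.twist_symm_twist] at h
  have h2 := he.twistIso.monotone h
  exact (he.twist_twist_symm _).symm.trans_le h2

variable (A) in
/-- The automorphism `θ` of the submodule `Y` is semilinear with respect to conjugation by `e`. -/
def IsLift {Y : Submodule A V} (e : V ≃ₗ[ℂ] V) (θ : Y ≃ₗ[ℂ] Y) : Prop :=
  ∀ a b : A, (∀ v : V, e (a • v) = b • e v) → ∀ y, θ (a • y) = b • θ y

variable {Y : Submodule A V}

/-- `e` carries `Y` semilinearly onto another simple submodule; homogeneity supplies an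
`A`-isomorphism from there back to `Y`. -/
lemma Normalizes.exists_isLift (he : Normalizes A e) [IsSimpleModule A Y] (h : IsIsotypicOfType A V Y) :
    ∃ θ : Y ≃ₗ[ℂ] Y, IsLift A e θ := by
  have := he.isSimpleModule_twist Y
  obtain ⟨f⟩ := h (he.twist Y)
  refine ⟨(he.twistEquiv Y).trans (f.restrictScalars ℂ), fun a b hab y => ?_⟩
  simp [he.twistEquiv_smul hab]

/-- The quotient `θ⁻¹ θ'` commutes with `A`, so Schur's lemma over `ℂ` makes it a scalar. -/
lemma Normalizes.isLift_unique (he : Normalizes A e) [FiniteDimensional ℂ V] [IsSimpleModule A Y] {θ θ' : Y ≃ₗ[ℂ] Y}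
    (h : IsLift A e θ) (h' : IsLift A e θ') : ∃ z : ℂˣ, ∀ y, θ' y = (z : ℂ) • θ y := by
  have : FiniteDimensional ℂ Y := inferInstanceAs (FiniteDimensional ℂ (Y.restrictScalars ℂ))
  let f : Module.End A Y :=
    { toFun := fun y => θ.symm (θ' y)
      map_add' := by simp
      map_smul' := fun a y => by
        obtain ⟨b, hb⟩ := he.1 a
        rw [h' a b hb, RingHom.id_apply, LinearEquiv.symm_apply_eq, h a b hb]
        simp }
  obtain ⟨c, hc⟩ := (IsSimpleModule.algebraMap_end_bijective_of_isAlgClosed ℂ (A := A)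
    (V := Y)).2 f
  have hf : ∀ y, θ' y = c • θ y := fun y => by
    have := LinearMap.congr_fun hc y
    rw [← map_smul, ← θ.symm_apply_eq]
    exact this.symm
  have : c ≠ 0 := by
    rintro rfl
    have := IsSimpleModule.nontrivial A Y
    obtain ⟨y, hy⟩ := exists_ne (0 : Y)
    exact hy (θ'.injective (by simpa using hf y))
  exact ⟨Units.mk0 c this, hf⟩

lemma IsLift.comp {e e' e'' : V ≃ₗ[ℂ] V} {θ θ' : Y ≃ₗ[ℂ] Y} (he' : Normalizes A e')
    (h : IsLift A e θ) (h' : IsLift A e' θ') {z : ℂˣ} (hz : ∀ v, e (e' v) = (z : ℂ) • e'' v) :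
    IsLift A e'' (θ'.trans θ) := by
  intro a c hac y
  obtain ⟨b, hb⟩ := he'.1 a
  rw [LinearEquiv.trans_apply, h' a b hb, h b c, LinearEquiv.trans_apply]
  intro v
  obtain ⟨v, rfl⟩ := e'.surjective v
  rw [← hb, hz, hac, hz, smul_comm]

/-- The automorphism `z ↦ e ∘ z ∘ θ⁻¹` of `Hom_A(Y, V)`. -/
def homTwist (e : V ≃ₗ[ℂ] V) (he : Normalizes A e) (θ : Y ≃ₗ[ℂ] Y) (h : IsLift A e θ) :
    (Y →ₗ[A] V) ≃ₗ[ℂ] (Y →ₗ[A] V) where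
  toFun z :=
    { toFun := fun y => e (z (θ.symm y))
      map_add' := by simp
      map_smul' := fun a y => by
        obtain ⟨b, hb'⟩ := he.exists_smul_eq a
        have : θ.symm (a • y) = b • θ.symm y := by
          rw [θ.symm_apply_eq, h b a hb', θ.apply_symm_apply]
        rw [this, map_smul, hb', RingHom.id_apply] }
  map_add' _ _ := by ext; simp
  map_smul' _ _ := by ext; simp
  invFun z :=
    { toFun := fun y => e.symm (z (θ y))
      map_add' := by simp
      map_smul' := fun a y => by
        obtain ⟨b, hb⟩ := he.1 a
        rw [h a b hb, map_smul, e.symm_apply_eq, RingHom.id_apply, hb, e.apply_symm_apply] }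
  left_inv z := by ext; simp
  right_inv z := by ext; simp

@[simp] lemma homTwist_apply (e : V ≃ₗ[ℂ] V) (he : Normalizes A e) (θ : Y ≃ₗ[ℂ] Y)
    (h : IsLift A e θ) (z : Y →ₗ[A] V) (y : Y) : homTwist e he θ h z y = e (z (θ.symm y)) := rfl

variable (Y) in
/-- Evaluation `Y ⊗ Hom_A(Y, V) → V`. -/
noncomputable def evalTensor : Y ⊗[ℂ] (Y →ₗ[A] V) →ₗ[ℂ] V :=
  TensorProduct.lift (LinearMap.mk₂ ℂ (fun y z => z y) (by simp)
    (fun c y z => LinearMap.map_smul_of_tower z c y) (by simp) (by simp))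

@[simp] lemma evalTensor_tmul (y : Y) (z : Y →ₗ[A] V) : evalTensor Y (y ⊗ₜ z) = z y := rfl

variable (Y) in
lemma finiteDimensional_hom [FiniteDimensional ℂ V] : FiniteDimensional ℂ (Y →ₗ[A] V) := by
  have : FiniteDimensional ℂ Y := inferInstanceAs (FiniteDimensional ℂ (Y.restrictScalars ℂ))
  have : FiniteDimensional ℂ (Y →ₗ[ℂ] V) := Module.Finite.linearMap ..
  exact .of_injective (LinearMap.restrictScalarsₗ ℂ A Y V ℂ) (LinearMap.restrictScalars_injective _)

/-- The dimension of `Hom_A(Y, Yⁿ)` is at most `n` for simple `Y`. -/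
lemma finrank_hom_le [FiniteDimensional ℂ V] [IsSimpleModule A Y] {n : ℕ}
    (ε : V ≃ₗ[A] (Fin n → Y)) : Module.finrank ℂ (Y →ₗ[A] V) ≤ n := by
  have : FiniteDimensional ℂ Y := inferInstanceAs (FiniteDimensional ℂ (Y.restrictScalars ℂ))
  have := finiteDimensional_hom Y
  let L := LinearEquiv.ofBijective (Algebra.linearMap ℂ (Module.End A Y))
    (IsSimpleModule.algebraMap_end_bijective_of_isAlgClosed ℂ (A := A) (V := Y))
  -- Each coordinate of a map `Y → Yⁿ` is an endomorphism of `Y`, hence a scalar; `M` records these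
  -- `n` scalars.
  let M : (Y →ₗ[A] V) →ₗ[ℂ] (Fin n → ℂ) :=
    { toFun := fun z i => L.symm (LinearMap.proj i ∘ₗ ε.toLinearMap ∘ₗ z)
      map_add' := fun z z' => by
        ext i
        rw [LinearMap.comp_add, LinearMap.comp_add, map_add]
        rfl
      map_smul' := fun c z => by
        ext i
        rw [RingHom.id_apply, Pi.smul_apply, ← map_smul]
        congr 1
        ext y
        exact congrArg Subtype.val (congr_fun (LinearMap.map_smul_of_tower ε.toLinearMap c (z y)) i) }
  have hM : Function.Injective M := by
    intro z z' h
    ext y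
    apply ε.injective
    ext i
    have := L.symm.injective (congr_fun h i)
    exact congrArg Subtype.val (LinearMap.congr_fun this y)
  simpa using LinearMap.finrank_le_finrank_of_injective hM

/-- With `V ≅ Yⁿ`, the `n` coordinate embeddings make evaluation surjective, and `dim Hom_A(Y, V) ≤
n` leaves no room for a kernel. -/
lemma evalTensor_bijective [FiniteDimensional ℂ V] [IsSimpleModule A Y]
    (hY : isotypicComponent A V Y = ⊤) : Function.Bijective (evalTensor Y) := by
  have : FiniteDimensional ℂ Y := inferInstanceAs (FiniteDimensional ℂ (Y.restrictScalars ℂ))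
  have := finiteDimensional_hom Y
  have : Module.Finite A V := Module.Finite.of_restrictScalars_finite ℂ A V
  have : IsSemisimpleModule A V := by
    have : IsSemisimpleModule A (⊤ : Submodule A V) := by
      rw [← hY]; infer_instance
    exact IsSemisimpleModule.congr (Submodule.topEquiv (R := A) (M := V)).symm
  obtain ⟨n, ⟨ε⟩⟩ := (IsIsotypicOfType.of_isotypicComponent_eq_top hY).linearEquiv_fun
  have hsurj : Function.Surjective (evalTensor Y) := by
    intro v
    refine ⟨∑ i, ε v i ⊗ₜ (ε.symm.toLinearMap ∘ₗ LinearMap.single A (fun _ => Y) i), ?_⟩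
    simp only [map_sum, evalTensor_tmul, LinearMap.comp_apply, LinearEquiv.coe_coe]
    rw [← map_sum, ε.symm_apply_eq]
    ext i
    simp [Finset.sum_apply, Pi.single_apply]
  have h1 := finrank_hom_le ε
  have h2 : Module.finrank ℂ V = n * Module.finrank ℂ Y := by
    rw [(ε.restrictScalars ℂ).finrank_eq, Module.finrank_pi_fintype]
    simp
  have h3 : Module.finrank ℂ (Y ⊗[ℂ] (Y →ₗ[A] V)) = Module.finrank ℂ V := by
    refine le_antisymm ?_ (LinearMap.finrank_le_finrank_of_surjective hsurj)
    rw [Module.finrank_tensorProduct, h2, mul_comm]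
    exact Nat.mul_le_mul_right _ h1
  exact ⟨(LinearMap.injective_iff_surjective_of_finrank_eq_finrank h3).2 hsurj, hsurj⟩

end normalizer

/-! ### Splitting a primitive module over a normal subgroup -/

namespace ProjRep

variable {G : Type u} [Group G] {V : Type v} [AddCommGroup V] [Module ℂ V] (φ : ProjRep G V)
  (N : Subgroup G)

/-- The algebra spanned by the action of `N`. -/
def actionAlgebra : Subalgebra ℂ (Module.End ℂ V) :=
  Algebra.adjoin ℂ {a | ∃ n ∈ N, a = (φ.toFun n : V →ₗ[ℂ] V)}

variable {N} in
/-- The action of an element of `N` as an element of the algebra spanned by `N`. -/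
def ofMem {n : G} (hn : n ∈ N) : φ.actionAlgebra N :=
  ⟨(φ.toFun n : V →ₗ[ℂ] V), Algebra.subset_adjoin ⟨n, hn, rfl⟩⟩

lemma ofMem_smul {n : G} (hn : n ∈ N) (v : V) : φ.ofMem hn • v = φ.toFun n v := rfl

lemma mem_of_smul_mem {W : Submodule ℂ V} (hW : ∀ n ∈ N, ∀ w ∈ W, φ.toFun n w ∈ W)
    (a : φ.actionAlgebra N) (w : V) (hw : w ∈ W) : a • w ∈ W := by
  obtain ⟨a, ha⟩ := a
  change a w ∈ W
  induction ha using Algebra.adjoin_induction generalizing w with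
  | mem x hx =>
    obtain ⟨n, hn, rfl⟩ := hx
    exact hW n hn w hw
  | algebraMap r => exact W.smul_mem r hw
  | add x y _ _ hx hy => exact W.add_mem (hx w hw) (hy w hw)
  | mul x y _ _ hx hy => exact hx _ (hy w hw)

/-- The elements that have a conjugate in the algebra are closed under the algebra operations, so
generators suffice. -/
lemma exists_conj (e : V ≃ₗ[ℂ] V)
    (h : ∀ n ∈ N, ∃ m ∈ N, ∃ z : ℂ, ∀ v, e (φ.toFun n v) = z • φ.toFun m (e v))
    (a : φ.actionAlgebra N) : ∃ b : φ.actionAlgebra N, ∀ v : V, e (a • v) = b • e v := by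
  obtain ⟨a, ha⟩ := a
  change ∃ b : φ.actionAlgebra N, ∀ v : V, e (a v) = b • e v
  induction ha using Algebra.adjoin_induction with
  | mem x hx =>
    obtain ⟨n, hn, rfl⟩ := hx
    obtain ⟨m, hm, z, hz⟩ := h n hn
    exact ⟨z • φ.ofMem hm, hz⟩
  | algebraMap r => exact ⟨algebraMap ℂ _ r, fun v => e.map_smul r v⟩
  | add x y _ _ hx hy =>
    obtain ⟨b, hb⟩ := hx
    obtain ⟨c, hc⟩ := hy
    exact ⟨b + c, fun v => by rw [LinearMap.add_apply, map_add, hb, hc, add_smul]⟩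
  | mul x y _ _ hx hy =>
    obtain ⟨b, hb⟩ := hx
    obtain ⟨c, hc⟩ := hy
    exact ⟨b * c, fun v => by rw [Module.End.mul_apply, hb, hc, mul_smul]⟩

lemma normalizes [hN : N.Normal] (g : G) : Normalizes (φ.actionAlgebra N) (φ.toFun g) := by
  constructor
  · refine φ.exists_conj N _ fun n hn => ⟨g * n * g⁻¹, hN.conj_mem n hn g, ?_⟩
    obtain ⟨z, hz⟩ := φ.exists_map_mul g n
    obtain ⟨z', hz'⟩ := φ.exists_map_mul (g * n * g⁻¹) g
    refine ⟨((z * z'⁻¹ : ℂˣ) : ℂ), fun v => ?_⟩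
    rw [hz, hz', inv_mul_cancel_right, smul_smul, ← Units.val_mul, inv_mul_cancel_right]
  · refine φ.exists_conj N _ fun n hn => ⟨g⁻¹ * n * g, by simpa using hN.conj_mem n hn g⁻¹, ?_⟩
    obtain ⟨z, hz⟩ := φ.exists_map_mul n g
    obtain ⟨z', hz'⟩ := φ.exists_map_mul g (g⁻¹ * n * g)
    refine ⟨((z * z'⁻¹ : ℂˣ) : ℂ), fun v => ?_⟩
    obtain ⟨v, rfl⟩ := (φ.toFun g).surjective v
    rw [LinearEquiv.symm_apply_eq, map_smul, LinearEquiv.symm_apply_apply, hz, hz',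
      ← mul_assoc, mul_inv_cancel_left, smul_smul, ← Units.val_mul, inv_mul_cancel_right]

variable {φ} in
/-- A primitive module is homogeneous on restriction to a normal subgroup. -/
lemma IsPrimitive.isotypicComponent_eq_top [N.Normal] (h : φ.IsPrimitive)
    (S : Submodule (φ.actionAlgebra N) V) [IsSimpleModule (φ.actionAlgebra N) S] :
    isotypicComponent (φ.actionAlgebra N) V S = ⊤ := by
  set C := isotypicComponent (φ.actionAlgebra N) V S with hC
  have hbot : C ≠ ⊥ := (bot_lt_isotypicComponent S).ne'
  have htr : ∀ g, φ.translate g (C.restrictScalars ℂ) =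
      ((φ.normalizes N g).twist C).restrictScalars ℂ := fun g => rfl
  have htop := h.2 (C.restrictScalars ℂ) (by simpa using hbot) (by
    have hmem : ∀ g, (φ.normalizes N g).twist C ∈ isotypicComponents (φ.actionAlgebra N) V := fun g =>
      ⟨_, (φ.normalizes N g).isSimpleModule_twist S, (φ.normalizes N g).twist_isotypicComponent S⟩
    -- Every translate of `C` is an isotypic component, and distinct components are independent, so
    -- `C` is a block.
    have hd := (sSupIndep_isotypicComponents (φ.actionAlgebra N) V) (show C ∈ _ from ⟨S, ‹_›, rfl⟩)
    rw [disjoint_iff] at hd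
    have hd' := congrArg (Submodule.restrictScalars ℂ) hd
    rw [Submodule.restrictScalars_bot, Submodule.restrictScalars_inf] at hd'
    refine (disjoint_iff.2 hd').mono_right (iSup₂_le fun g hg => ?_)
    rw [htr]
    have hle : (φ.normalizes N g).twist C ≤
        sSup (isotypicComponents (φ.actionAlgebra N) V \ {C}) := by
      refine le_sSup ⟨hmem g, fun hh => hg ?_⟩
      rw [htr, Set.mem_singleton_iff.1 hh]
    exact fun x hx => hle hx)
  simpa using htop

/-- A simple submodule for the algebra spanned by `N` is irreducible under the action of `N`. -/
lemma eq_bot_or_eq_top_of_isSimpleModule (Y : Submodule (φ.actionAlgebra N) V)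
    [IsSimpleModule (φ.actionAlgebra N) Y] (t : G → Y ≃ₗ[ℂ] Y)
    (htN : ∀ n ∈ N, ∃ z : ℂˣ, ∀ y : Y, φ.toFun n (y : V) = (z : ℂ) • (t n y : V))
    (W : Submodule ℂ Y) (hW : ∀ n ∈ N, ∀ w ∈ W, t n w ∈ W) : W = ⊥ ∨ W = ⊤ := by
  let W' : Submodule (φ.actionAlgebra N) Y :=
    { W with
      smul_mem' := fun a w hw => by
        have hinv := φ.mem_of_smul_mem N (W := W.map (Y.subtype.restrictScalars ℂ)) (by
          rintro n hn _ ⟨w, hw, rfl⟩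
          obtain ⟨z, hz⟩ := htN n hn
          exact ⟨(z : ℂ) • t n w, W.smul_mem _ (hW n hn w hw), (hz w).symm⟩) a (w : V)
          ⟨w, hw, rfl⟩
        obtain ⟨w', hw', he⟩ := hinv
        have : w' = a • w := Subtype.ext he
        exact this ▸ hw' }
  have hW' : W'.restrictScalars ℂ = W := rfl
  rw [← hW']
  have := (isSimpleModule_iff (φ.actionAlgebra N) Y).1 ‹_›
  rcases IsSimpleOrder.eq_bot_or_eq_top W' with h | h
  · left; rw [h]; rfl
  · right; rw [h]; rfl

/-- An element of `N` acts on `Hom(Y, V)` by the scalar by which its two actions on `Y` differ. -/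
lemma homTwist_eq_smul {Y : Submodule (φ.actionAlgebra N) V} {n : G} (hn : n ∈ N)
    (he : Normalizes (φ.actionAlgebra N) (φ.toFun n)) (θ : Y ≃ₗ[ℂ] Y)
    (h : IsLift (φ.actionAlgebra N) (φ.toFun n) θ) (z : ℂ)
    (hz : ∀ y : Y, φ.toFun n (y : V) = z • (θ y : V)) (f : Y →ₗ[φ.actionAlgebra N] V) :
    homTwist _ he θ h f = z • f := by
  ext y
  obtain ⟨y, rfl⟩ := θ.surjective y
  have h1 : φ.ofMem hn • y = z • θ y := Subtype.ext (hz y)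
  rw [homTwist_apply, LinearEquiv.symm_apply_apply, LinearMap.smul_apply,
    ← φ.ofMem_smul N hn, ← map_smul, h1, LinearMap.map_smul_of_tower]

variable {φ} in
/-- A primitive module is a tensor product of a module irreducible on `N` and a module on which
`N` acts by scalars. -/
theorem IsPrimitive.exists_tensor_equiv [FiniteDimensional ℂ V] [N.Normal] (h : φ.IsPrimitive) :
    ∃ (Y Z : Type v) (_ : AddCommGroup Y) (_ : Module ℂ Y) (_ : AddCommGroup Z) (_ : Module ℂ Z)
      (_ : FiniteDimensional ℂ Y) (_ : FiniteDimensional ℂ Z) (θ : ProjRep G Y)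
      (ζ : ProjRep G Z) (μ : Y ⊗[ℂ] Z ≃ₗ[ℂ] V),
      (∀ g y z, μ (θ.toFun g y ⊗ₜ ζ.toFun g z) = φ.toFun g (μ (y ⊗ₜ z))) ∧
      θ.IrreducibleOn N ∧ ζ.ScalarOn N := by
  have := h.1
  have : IsArtinian (φ.actionAlgebra N) V := isArtinian_of_tower ℂ inferInstance
  obtain ⟨Y, hY⟩ := IsAtomic.exists_atom (Submodule (φ.actionAlgebra N) V)
  rw [← isSimpleModule_iff_isAtom] at hY
  have htop := h.isotypicComponent_eq_top N Y
  have hlift := fun g => (φ.normalizes N g).exists_isLift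
    (IsIsotypicOfType.of_isotypicComponent_eq_top htop)
  choose t ht using hlift
  have htmul : ∀ x y, ∃ z : ℂˣ, ∀ v, t x (t y v) = (z : ℂ) • t (x * y) v := fun x y => by
    obtain ⟨z, hz⟩ := φ.exists_map_mul x y
    exact (φ.normalizes N (x * y)).isLift_unique (ht (x * y))
      ((ht x).comp (φ.normalizes N y) (ht y) hz)
  have htN : ∀ n ∈ N, ∃ z : ℂˣ, ∀ y : Y, φ.toFun n (y : V) = (z : ℂ) • (t n y : V) := by
    intro n hn
    have hmem : (Y.restrictScalars ℂ).map (φ.toFun n : V →ₗ[ℂ] V) = Y.restrictScalars ℂ := by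
      apply Submodule.eq_of_le_of_finrank_eq
      · rintro _ ⟨y, hy, rfl⟩
        exact Y.smul_mem (φ.ofMem hn) hy
      · exact ((φ.toFun n).submoduleMap (Y.restrictScalars ℂ)).finrank_eq.symm
    -- For `n ∈ N`, the genuine restriction of the action to `Y` is also a lift, so it agrees with
    -- `t n` up to a scalar.
    let r : Y ≃ₗ[ℂ] Y := ((φ.toFun n).submoduleMap (Y.restrictScalars ℂ)).trans
      (LinearEquiv.ofEq _ _ hmem)
    obtain ⟨z, hz⟩ := (φ.normalizes N n).isLift_unique (ht n)
      (show IsLift (φ.actionAlgebra N) (φ.toFun n) r from fun a b hab y => Subtype.ext (hab y))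
    exact ⟨z, fun y => congrArg Subtype.val (hz y)⟩
  have hYfin : FiniteDimensional ℂ Y :=
    inferInstanceAs (FiniteDimensional ℂ (Y.restrictScalars ℂ))
  have hZfin := finiteDimensional_hom Y
  obtain ⟨ζ, hζ⟩ : ∃ ζ : ProjRep G (Y →ₗ[φ.actionAlgebra N] V),
      ∀ g, ζ.toFun g = homTwist _ (φ.normalizes N g) (t g) (ht g) := by
    refine ⟨⟨fun g => homTwist _ (φ.normalizes N g) (t g) (ht g), fun x y => ?_⟩, fun g => rfl⟩
    obtain ⟨z, hz⟩ := φ.exists_map_mul x y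
    obtain ⟨z', hz'⟩ := htmul x y
    refine ⟨z * z'⁻¹, fun f => ?_⟩
    ext v
    obtain ⟨v, rfl⟩ := (t (x * y)).surjective v
    have : (t y).symm ((t x).symm (t (x * y) v)) = ((z'⁻¹ : ℂˣ) : ℂ) • v := by
      rw [LinearEquiv.symm_apply_eq, LinearEquiv.symm_apply_eq, map_smul, map_smul, hz',
        smul_smul, ← Units.val_mul]
      simp
    simp only [homTwist_apply, LinearMap.smul_apply, LinearEquiv.symm_apply_apply, hz, this]
    rw [LinearMap.map_smul_of_tower, map_smul, smul_smul, Units.val_mul]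
  have hirr : (ProjRep.mk t htmul).IrreducibleOn N :=
    ⟨IsSimpleModule.nontrivial (φ.actionAlgebra N) Y,
      φ.eq_bot_or_eq_top_of_isSimpleModule N Y t htN⟩
  have hscal : ζ.ScalarOn N := fun n hn => by
    obtain ⟨z, hz⟩ := htN n hn
    refine ⟨z, fun f => ?_⟩
    rw [hζ]
    exact φ.homTwist_eq_smul N hn _ _ (ht n) z hz f
  have hequi : ∀ g y z, evalTensor Y ((ProjRep.mk t htmul).toFun g y ⊗ₜ ζ.toFun g z) =
      φ.toFun g (evalTensor Y (y ⊗ₜ z)) := fun g y z => by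
    simp [hζ]
  exact ⟨Y, Y →ₗ[φ.actionAlgebra N] V, _, _, _, _, hYfin, hZfin, ⟨t, htmul⟩, ζ,
    LinearEquiv.ofBijective (evalTensor Y) (evalTensor_bijective htop), hequi, hirr, hscal⟩

end ProjRep

/-! ### Subspaces and scalars in a tensor factorization -/

namespace ProjRep

section tensor

variable {G : Type u} [Group G] {V Y Z : Type v} [AddCommGroup V] [Module ℂ V] [AddCommGroup Y]
  [Module ℂ Y] [AddCommGroup Z] [Module ℂ Z] {φ : ProjRep G V} {θ : ProjRep G Y}
  {ζ : ProjRep G Z} (μ : Y ⊗[ℂ] Z ≃ₗ[ℂ] V)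

/-- The subspace of `V ≅ Y ⊗ Z` that corresponds to `Y ⊗ S`. -/
def tensorRight (S : Submodule ℂ Z) : Submodule ℂ V :=
  ⨆ y : Y, S.map (μ.toLinearMap ∘ₗ TensorProduct.mk ℂ Y Z y)

lemma apply_mem_tensorRight {S : Submodule ℂ Z} (y : Y) {z : Z} (hz : z ∈ S) :
    μ (y ⊗ₜ z) ∈ tensorRight μ S :=
  Submodule.mem_iSup_of_mem y ⟨z, hz, rfl⟩

lemma tensorRight_le {S : Submodule ℂ Z} {W : Submodule ℂ V}
    (h : ∀ y, ∀ z ∈ S, μ (y ⊗ₜ z) ∈ W) : tensorRight μ S ≤ W := by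
  refine iSup_le fun y => ?_
  rintro _ ⟨z, hz, rfl⟩
  exact h y z hz

lemma tensorRight_mono {S T : Submodule ℂ Z} (h : S ≤ T) : tensorRight μ S ≤ tensorRight μ T :=
  tensorRight_le μ fun y _ hz => apply_mem_tensorRight μ y (h hz)

lemma disjoint_tensorRight {S T : Submodule ℂ Z} (h : Disjoint S T) :
    Disjoint (tensorRight μ S) (tensorRight μ T) := by
  obtain ⟨S', hS, hc⟩ := h.exists_isCompl
  -- Projection along `Y ⊗ T`, with `S'` a complement of `T` containing `S`: it is the identity on
  -- `Y ⊗ S` and zero on `Y ⊗ T`.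
  let P : V →ₗ[ℂ] V :=
    μ.toLinearMap ∘ₗ (S'.projection T hc).lTensor Y ∘ₗ μ.symm.toLinearMap
  have h1 : tensorRight μ S ≤ LinearMap.eqLocus P LinearMap.id := by
    refine tensorRight_le μ fun y z hz => ?_
    simp [P, LinearMap.mem_eqLocus, Submodule.projection_apply_of_mem_left hc (hS hz)]
  have h2 : tensorRight μ T ≤ LinearMap.ker P := by
    refine tensorRight_le μ fun y z hz => ?_
    simp [P, (Submodule.projection_apply_eq_zero_iff hc).2 hz]
  rw [Submodule.disjoint_def]
  intro x hx hx'
  exact (h1 hx).symm.trans (h2 hx')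

lemma eq_bot_of_tensorRight_eq_bot [Nontrivial Y] {S : Submodule ℂ Z}
    (h : tensorRight μ S = ⊥) : S = ⊥ := by
  rw [eq_bot_iff]
  intro z hz
  obtain ⟨y, hy⟩ := exists_ne (0 : Y)
  have h1 : μ (y ⊗ₜ z) ∈ (⊥ : Submodule ℂ V) := h ▸ apply_mem_tensorRight μ y hz
  rw [Submodule.mem_bot, LinearEquiv.map_eq_zero_iff] at h1
  obtain ⟨f, hf⟩ := Module.Projective.exists_dual_ne_zero ℂ hy
  have h2 := congrArg (TensorProduct.lid ℂ Z ∘ f.rTensor Z) h1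
  simpa [hf] using h2

lemma eq_top_of_tensorRight_eq_top [Nontrivial Y] {S : Submodule ℂ Z}
    (h : tensorRight μ S = ⊤) : S = ⊤ := by
  obtain ⟨T, hT⟩ := exists_isCompl S
  have h1 := disjoint_tensorRight μ hT.disjoint
  rw [h, top_disjoint] at h1
  have h2 := eq_bot_of_tensorRight_eq_bot μ h1
  have h3 := hT.sup_eq_top
  rwa [h2, sup_bot_eq] at h3

variable (hμ : ∀ g y z, μ (θ.toFun g y ⊗ₜ ζ.toFun g z) = φ.toFun g (μ (y ⊗ₜ z)))

include hμ in
lemma translate_tensorRight (g : G) (S : Submodule ℂ Z) :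
    φ.translate g (tensorRight μ S) = tensorRight μ (ζ.translate g S) := by
  apply le_antisymm
  · rw [translate, Submodule.map_le_iff_le_comap]
    refine tensorRight_le μ fun y z hz => ?_
    rw [Submodule.mem_comap, LinearEquiv.coe_coe, ← hμ]
    exact apply_mem_tensorRight μ _ (ζ.mem_translate_of_mem hz)
  · refine tensorRight_le μ ?_
    rintro y _ ⟨z, hz, rfl⟩
    obtain ⟨y, rfl⟩ := (θ.toFun g).surjective y
    rw [LinearEquiv.coe_coe, hμ]
    exact φ.mem_translate_of_mem (apply_mem_tensorRight μ y hz)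

include hμ in
/-- A tensor factor of a primitive module is primitive. -/
lemma IsPrimitive.of_tensor [Nontrivial Y] (h : φ.IsPrimitive) : ζ.IsPrimitive := by
  constructor
  · by_contra hZ
    rw [not_nontrivial_iff_subsingleton] at hZ
    have := h.1
    exact not_subsingleton V μ.symm.injective.subsingleton
  · intro S hS hb
    refine eq_top_of_tensorRight_eq_top μ (h.2 _ (mt (eq_bot_of_tensorRight_eq_bot μ) hS) ?_)
    refine (disjoint_tensorRight μ hb).mono_right (iSup₂_le fun g hg => ?_)
    rw [translate_tensorRight μ hμ] at hg ⊢
    exact tensorRight_mono μ (le_iSup₂_of_le g (fun e => hg (by rw [e])) le_rfl)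

include hμ in
lemma ScalarOn.of_tensor [Nontrivial Z] {M N : Subgroup G} (hMN : M ≤ N) (hφ : φ.ScalarOn M)
    (hζ : ζ.ScalarOn N) : θ.ScalarOn M := by
  intro n hn
  obtain ⟨a, ha⟩ := hφ n hn
  obtain ⟨b, hb⟩ := hζ n (hMN hn)
  refine ⟨a * b⁻¹, fun y => ?_⟩
  obtain ⟨z, hz⟩ := exists_ne (0 : Z)
  -- A functional not vanishing at `z` cancels the second tensor factor, so `n` acts on `Y` by the
  -- ratio of its scalars on `V` and `Z`.
  obtain ⟨f, hf⟩ := Module.Projective.exists_dual_ne_zero ℂ hz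
  have h1 := hμ n y z
  rw [ha, hb, ← map_smul, μ.injective.eq_iff] at h1
  have h2 := congrArg (TensorProduct.rid ℂ Y ∘ f.lTensor Y) h1
  simp only [Function.comp_apply, TensorProduct.tmul_smul, map_smul, LinearMap.lTensor_tmul,
    TensorProduct.rid_tmul] at h2
  rw [smul_comm, smul_comm (a : ℂ)] at h2
  have h3 := smul_right_injective Y hf h2
  rw [Units.val_mul, mul_comm, mul_smul, ← h3, smul_smul, ← Units.val_mul, inv_mul_cancel,
    Units.val_one, one_smul]

end tensor

end ProjRep

/-! ### Finite tensor products and iteration along the series -/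

section piTensor

variable {n : ℕ} (M : Fin (n + 1) → Type v) [∀ i, AddCommGroup (M i)] [∀ i, Module ℂ (M i)]

/-- The first factor splits off a tensor product of a finite sequence. -/
noncomputable def piTensorConsEquiv :
    M 0 ⊗[ℂ] (⨂[ℂ] i : Fin n, M i.succ) ≃ₗ[ℂ] ⨂[ℂ] i, M i :=
  LinearEquiv.ofLinearMap
    (TensorProduct.lift
      ((PiTensorProduct.lift (R := ℂ) (s := fun i : Fin n => M i.succ)
        (E := ⨂[ℂ] i, M i)).toLinearMap ∘ₗ (PiTensorProduct.tprod ℂ (s := M)).curryLeft))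
    (PiTensorProduct.lift (LinearMap.uncurryLeft
      { toFun := fun m => (TensorProduct.mk ℂ (M 0) (⨂[ℂ] i : Fin n, M i.succ) m).compMultilinearMap
          (PiTensorProduct.tprod ℂ)
        map_add' := fun _ _ => by ext; simp
        map_smul' := fun _ _ => by ext; simp [TensorProduct.smul_tmul'] }))
    (by
      apply PiTensorProduct.ext
      ext m
      simp)
    (by
      apply TensorProduct.ext
      ext m m'
      simp)

lemma piTensorConsEquiv_tmul_tprod (m : M 0) (m' : ∀ i : Fin n, M i.succ) :
    piTensorConsEquiv M (m ⊗ₜ PiTensorProduct.tprod ℂ m') =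
      PiTensorProduct.tprod ℂ (Fin.cons m m' : ∀ i, M i) := by
  simp [piTensorConsEquiv]

lemma piTensorConsEquiv_congr (f : ∀ i, M i ≃ₗ[ℂ] M i) (m : M 0)
    (x : ⨂[ℂ] i : Fin n, M i.succ) :
    piTensorConsEquiv M (f 0 m ⊗ₜ PiTensorProduct.congr (fun i => f i.succ) x) =
      PiTensorProduct.congr f (piTensorConsEquiv M (m ⊗ₜ x)) := by
  induction x using PiTensorProduct.induction_on with
  | smul_tprod r m' =>
    simp only [map_smul, TensorProduct.tmul_smul, PiTensorProduct.congr_tprod,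
      piTensorConsEquiv_tmul_tprod]
    congr 2
    ext i
    refine Fin.cases ?_ (fun i => ?_) i <;> simp
  | add x y hx hy => simp only [map_add, TensorProduct.tmul_add, hx, hy]

lemma piTensor_congr_smul {ι : Type w} [Fintype ι] {Y : ι → Type v} [∀ i, AddCommGroup (Y i)]
    [∀ i, Module ℂ (Y i)] {f f' : ∀ i, Y i ≃ₗ[ℂ] Y i} {z : ι → ℂ}
    (h : ∀ i y, f i y = z i • f' i y) (x : ⨂[ℂ] i, Y i) :
    PiTensorProduct.congr f x = (∏ i, z i) • PiTensorProduct.congr f' x := by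
  induction x using PiTensorProduct.induction_on with
  | smul_tprod r m =>
    simp only [map_smul, PiTensorProduct.congr_tprod, h, MultilinearMap.map_smul_univ]
    rw [smul_comm]
  | add x y hx hy => simp only [map_add, smul_add, hx, hy]

end piTensor

/-- A finite-dimensional space with a projective action. -/
structure BundledProjRep (G : Type u) [Group G] : Type (max u (v + 1)) where
  carrier : Type v
  [addCommGroup : AddCommGroup carrier]
  [module : Module ℂ carrier]
  [finiteDimensional : FiniteDimensional ℂ carrier]
  rep : ProjRep G carrier

attribute [instance] BundledProjRep.addCommGroup BundledProjRep.module
  BundledProjRep.finiteDimensional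

namespace ProjRep

/-- A primitive module is the tensor product of modules that correspond to the factors of
a normal series. -/
theorem IsPrimitive.exists_piTensor_equiv {G : Type u} [Group G] (l : ℕ) :
    ∀ (N : Fin (l + 1) → Subgroup G) (_ : ∀ i, (N i).Normal) (_ : Monotone N)
      (_ : N (Fin.last l) = ⊤) (V : Type v) [AddCommGroup V] [Module ℂ V]
      [FiniteDimensional ℂ V] (φ : ProjRep G V) (_ : φ.IsPrimitive) (_ : φ.ScalarOn (N 0)),
    ∃ Y : Fin l → BundledProjRep.{u, v} G,
      (∀ i, (Y i).rep.ScalarOn (N i.castSucc)) ∧ (∀ i, (Y i).rep.IrreducibleOn (N i.succ)) ∧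
      ∃ e : (⨂[ℂ] i, (Y i).carrier) ≃ₗ[ℂ] V, ∀ g, ∃ z : ℂˣ, ∀ x,
        φ.toFun g (e x) = (z : ℂ) • e (PiTensorProduct.congr (fun i => (Y i).rep.toFun g) x) := by
  induction l with
  | zero =>
    intro N _ _ htop V _ _ _ φ hφ h0
    rw [show (0 : Fin (0 + 1)) = Fin.last 0 from rfl, htop] at h0
    have := hφ.1
    obtain ⟨v, hv⟩ := exists_ne (0 : V)
    -- For a series of length zero the whole group acts by scalars, so every line is invariant and
    -- `V` is one-dimensional, matching the empty tensor product `ℂ`.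
    have hspan : Submodule.span ℂ {v} = ⊤ := by
      refine hφ.eq_top_of_invariant (by simpa using hv) fun g => ?_
      obtain ⟨z, hz⟩ := h0 g trivial
      rw [translate, Submodule.map_span, Set.image_singleton, LinearEquiv.coe_coe, hz]
      exact Submodule.span_singleton_smul_eq z.isUnit v
    let e₀ : ℂ ≃ₗ[ℂ] V := (LinearEquiv.toSpanNonzeroSingleton ℂ V v hv).trans
      ((LinearEquiv.ofEq _ _ hspan).trans Submodule.topEquiv)
    refine ⟨fun i => i.elim0, fun i => i.elim0, fun i => i.elim0,
      (PiTensorProduct.isEmptyEquiv _).trans e₀, fun g => ?_⟩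
    obtain ⟨z, hz⟩ := h0 g trivial
    refine ⟨z, fun x => ?_⟩
    rw [hz]
    congr 2
    induction x using PiTensorProduct.induction_on with
    | smul_tprod r m =>
      simp only [map_smul, PiTensorProduct.congr_tprod]
      congr 2
      exact Subsingleton.elim _ _
    | add x y hx hy => rw [map_add, ← hx, ← hy]
  | succ l ih =>
    intro N hN hmono htop V _ _ _ φ hφ h0
    have := hN 1
    -- Splitting at `N 1` gives the first factor `Y₀`; on `Z`, `N 1` is scalar, which is the base
    -- condition for the shifted series.
    obtain ⟨Y₀, Z, _, _, _, _, _, _, θ, ζ, μ, hμ, hθ, hζ⟩ := hφ.exists_tensor_equiv (N 1)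
    have := hθ.1
    have hZ := hφ.of_tensor μ hμ
    have := hZ.1
    obtain ⟨Y, h1, h2, e, he⟩ := ih (fun i => N i.succ) (fun i => hN _)
      (fun i j h => hmono (Fin.succ_le_succ_iff.2 h)) htop Z ζ hZ hζ
    let Y' : Fin (l + 1) → BundledProjRep.{u, v} G := Fin.cons ⟨Y₀, θ⟩ Y
    refine ⟨Y', ?_, ?_, ?_⟩
    · refine Fin.cases ?_ h1
      exact ScalarOn.of_tensor μ hμ (hmono (Fin.zero_le 1)) h0 hζ
    · exact Fin.cases hθ h2
    · let E := (piTensorConsEquiv fun i => (Y' i).carrier)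
      let F : (Y' 0).carrier ⊗[ℂ] (⨂[ℂ] i : Fin l, (Y' i.succ).carrier) ≃ₗ[ℂ] V :=
        (TensorProduct.congr (LinearEquiv.refl ℂ Y₀) e).trans μ
      refine ⟨E.symm.trans F, fun g => ?_⟩
      obtain ⟨z, hz⟩ := he g
      have key : ∀ (y : Y₀) (x : ⨂[ℂ] i, (Y i).carrier), φ.toFun g (μ (y ⊗ₜ e x)) =
          (z : ℂ) • μ (θ.toFun g y ⊗ₜ
            e (PiTensorProduct.congr (fun i => (Y i).rep.toFun g) x)) := fun y x => by
        rw [← hμ, hz, TensorProduct.tmul_smul, map_smul]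
      refine ⟨z, fun x => ?_⟩
      obtain ⟨x, rfl⟩ := E.surjective x
      induction x using TensorProduct.induction_on with
      | zero => simp
      | add x y hx hy => simp only [map_add, smul_add, hx, hy]
      | tmul y x =>
        have h3 := piTensorConsEquiv_congr (fun i => (Y' i).carrier)
          (fun i => (Y' i).rep.toFun g) y x
        rw [← h3]
        rw [LinearEquiv.trans_apply, LinearEquiv.trans_apply, E.symm_apply_apply,
          E.symm_apply_apply]
        exact key y x

end ProjRep

/-! ### Recovering cocycles and coclasses -/

namespace ProjRep

variable {G : Type u} [Group G] {V : Type v} [AddCommGroup V] [Module ℂ V] (φ : ProjRep G V)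

lemma scalarOn_bot : φ.ScalarOn ⊥ := by
  intro n hn
  rw [Subgroup.mem_bot] at hn
  subst hn
  obtain ⟨z, hz⟩ := φ.exists_map_mul 1 1
  refine ⟨z, fun v => (φ.toFun 1).injective ?_⟩
  rw [hz, mul_one, map_smul]

/-- A projective action on a nonzero space has a cocycle. -/
lemma exists_twistedRep [Nontrivial V] :
    ∃ (γ : SchurCocycle G) (σ : TwistedRep γ V), σ.toFun = φ.toFun := by
  choose γ hγ using φ.exists_map_mul
  refine ⟨⟨γ, fun x y z => ?_⟩, ⟨φ.toFun, hγ⟩, rfl⟩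
  obtain ⟨v, hv⟩ := exists_ne (0 : V)
  have h1 := hγ x y (φ.toFun z v)
  rw [hγ y z, map_smul, hγ x (y * z), hγ (x * y) z, smul_smul, smul_smul, mul_assoc] at h1
  have h2 := smul_left_injective ℂ
    (show φ.toFun (x * (y * z)) v ≠ 0 by simpa using hv) h1
  rw [← Units.val_mul, ← Units.val_mul, Units.val_inj] at h2
  rw [← h2, mul_comm]

/-- A projective action that is scalar on a normal subgroup comes from the quotient. -/
lemma ScalarOn.exists_infl [Nontrivial V] {φ : ProjRep G V} {K : Subgroup G} [K.Normal]
    (h : φ.ScalarOn K) : ∃ (γ : SchurCocycle (G ⧸ K)) (σ : TwistedRep γ V),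
      ∀ g, ∃ z : ℂˣ, ∀ v, (σ.infl K).toFun g v = (z : ℂ) • φ.toFun g v := by
  have hmul : ∀ g, ∀ k ∈ K, ∃ z : ℂˣ, ∀ v, φ.toFun (g * k) v = (z : ℂ) • φ.toFun g v := by
    intro g k hk
    obtain ⟨a, ha⟩ := φ.exists_map_mul g k
    obtain ⟨b, hb⟩ := h k hk
    refine ⟨a⁻¹ * b, fun v => ?_⟩
    rw [Units.val_mul, mul_smul, ← map_smul, ← hb, ha, smul_smul, ← Units.val_mul]
    simp
  have hout : ∀ g : G, ∃ z : ℂˣ, ∀ v,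
      φ.toFun (g : G ⧸ K).out v = (z : ℂ) • φ.toFun g v := by
    intro g
    obtain ⟨k, hk⟩ := QuotientGroup.mk_out_eq_mul K g
    rw [hk]
    exact hmul g k k.2
  -- Coset representatives define the action; changing a representative changes it only by a scalar.
  let τ : ProjRep (G ⧸ K) V :=
    { toFun := fun q => φ.toFun q.out
      exists_map_mul := fun x y => by
        obtain ⟨a, ha⟩ := φ.exists_map_mul x.out y.out
        obtain ⟨b, hb⟩ := hout (x.out * y.out)
        have e : ((x.out * y.out : G) : G ⧸ K) = x * y := by simp
        rw [e] at hb
        refine ⟨a * b⁻¹, fun v => ?_⟩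
        rw [ha, hb, smul_smul, ← Units.val_mul, inv_mul_cancel_right] }
  obtain ⟨γ, σ, hσ⟩ := τ.exists_twistedRep
  refine ⟨γ, σ, fun g => ?_⟩
  obtain ⟨z, hz⟩ := hout g
  exact ⟨z, fun v => by rw [← hz]; change σ.toFun _ v = _; rw [hσ]; rfl⟩

lemma IrreducibleOn.of_smul {φ : ProjRep G V} {N : Subgroup G} (h : φ.IrreducibleOn N)
    {α : SchurCocycle G} {σ : TwistedRep α V}
    (hσ : ∀ g, ∃ z : ℂˣ, ∀ v, σ.toFun g v = (z : ℂ) • φ.toFun g v) :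
    (σ.res N).IsIrreducible := by
  refine ⟨h.1, fun W hW => h.2 W fun n hn w hw => ?_⟩
  obtain ⟨z, hz⟩ := hσ n
  have h1 := W.smul_mem ((z⁻¹ : ℂˣ) : ℂ) (hW ⟨n, hn⟩ w hw)
  change ((z⁻¹ : ℂˣ) : ℂ) • σ.toFun n w ∈ W at h1
  rwa [hz, smul_smul, ← Units.val_mul, inv_mul_cancel, Units.val_one, one_smul] at h1

end ProjRep

lemma SchurMultiplier.comap_coclass {G : Type u} {H : Type v} [Group G] [Group H] (f : H →* G)
    (α : SchurCocycle G) : SchurMultiplier.comap f (SchurCocycle.coclass α) =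
      SchurCocycle.coclass (SchurCocycle.comap f α) := rfl

lemma SchurCocycle.coclass_prod {G : Type u} [Group G] {ι : Type w} [Fintype ι]
    (γ : ι → SchurCocycle G) :
    SchurCocycle.coclass (∏ i, γ i) = ∏ i, SchurCocycle.coclass (γ i) :=
  map_prod (QuotientGroup.mk' (schurCoboundary G).range) γ Finset.univ

/-- Rescaling a section by `ζ` multiplies its cocycle by `δζ`; a nonzero vector lets the scalars be
compared. -/
lemma TwistedRep.SameProjective.coclass_eq {G : Type u} [Group G] {α β : SchurCocycle G}
    {V : Type v} [AddCommGroup V] [Module ℂ V] [Nontrivial V] {φ : TwistedRep α V}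
    {ψ : TwistedRep β V} (h : φ.SameProjective ψ) :
    SchurCocycle.coclass α = SchurCocycle.coclass β := by
  choose ζ hζ using h
  refine ((QuotientGroup.eq (s := (schurCoboundary G).range)).2 ⟨ζ, ?_⟩).symm
  apply Subtype.ext
  funext x y
  obtain ⟨v, hv⟩ := exists_ne (0 : V)
  have h1 := φ.map_mul x y v
  rw [hζ, hζ, hζ, map_smul, ψ.map_mul, smul_smul, smul_smul, smul_smul] at h1
  have h2 := smul_left_injective ℂ (show ψ.toFun (x * y) v ≠ 0 by simpa using hv) h1
  simp only [← Units.val_mul, Units.val_inj] at h2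
  change ζ x * ζ y * (ζ (x * y))⁻¹ = (β.1 x y)⁻¹ * α.1 x y
  rw [mul_inv_eq_iff_eq_mul, mul_assoc, ← h2]
  rw [mul_comm (ζ x * ζ y), inv_mul_cancel_left]

namespace TwistedRep

variable {G : Type u} [Group G] {α : SchurCocycle G} {V : Type v} [AddCommGroup V] [Module ℂ V]

/-- The action of the stabilizer of a subspace on that subspace. -/
noncomputable def subrep (φ : TwistedRep α V) (W : Submodule ℂ V) :
    TwistedRep (SchurCocycle.res (φ.toProjRep.stabilizer W) α) W where
  toFun := (φ.toProjRep.subrep _ W le_rfl).toFun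
  map_mul x y v := Subtype.ext (φ.map_mul x y v)

lemma SameProjective.of_piTensor_equiv {ι : Type w} [Fintype ι] {γ : ι → SchurCocycle G}
    {Y : ι → Type v} [∀ i, AddCommGroup (Y i)] [∀ i, Module ℂ (Y i)]
    (σ : ∀ i, TwistedRep (γ i) (Y i)) (ρ : ∀ i, ProjRep G (Y i)) (φ : TwistedRep α V)
    (hσ : ∀ i g, ∃ z : ℂˣ, ∀ y, (σ i).toFun g y = (z : ℂ) • (ρ i).toFun g y)
    (e : (⨂[ℂ] i, Y i) ≃ₗ[ℂ] V)
    (he : ∀ g, ∃ z : ℂˣ, ∀ x, φ.toFun g (e x) =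
      (z : ℂ) • e (PiTensorProduct.congr (fun i => (ρ i).toFun g) x)) :
    (φ.transport e.symm).SameProjective (tensor σ) := by
  intro g
  choose z hz using fun i => hσ i g
  obtain ⟨a, ha⟩ := he g
  refine ⟨a * (∏ i, z i)⁻¹, fun x => ?_⟩
  have h1 := piTensor_congr_smul (z := fun i => (z i : ℂ)) hz x
  change e.symm (φ.toFun g (e x)) = _ • PiTensorProduct.congr (fun i => (σ i).toFun g) x
  rw [h1, ha, map_smul, e.symm_apply_apply, ← Units.coe_prod, smul_smul, ← Units.val_mul,
    inv_mul_cancel_right]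

end TwistedRep

/-! ### Assembly of the theorem -/

theorem mainTheorem7 {G : Type u} [Group G] [Finite G]
    (l : ℕ) (N : Fin (l + 1) → Subgroup G) [∀ i, (N i).Normal]
    (hmono : Monotone N) (hbot : N 0 = ⊥) (htop : N (Fin.last l) = ⊤)
    (c : SchurMultiplier G) (α : SchurCocycle G) (hα : SchurCocycle.coclass α = c)
    (V : Type v) [AddCommGroup V] [Module ℂ V] [FiniteDimensional ℂ V]
    (φ : TwistedRep α V) (hφ : φ.IsIrreducible) :
    ∃ (J : Subgroup G)
      (d : ∀ i : Fin l, SchurMultiplier (J ⧸ (N i.castSucc).subgroupOf J))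
      (γ : ∀ i : Fin l, SchurCocycle (J ⧸ (N i.castSucc).subgroupOf J))
      (Y : Fin l → Type v)
      (_ : ∀ i, AddCommGroup (Y i)) (_ : ∀ i, Module ℂ (Y i))
      (ρ : ∀ i, TwistedRep (γ i) (Y i)),
      (∀ i, SchurCocycle.coclass (γ i) = d i) ∧
      (∀ i, FiniteDimensional ℂ (Y i)) ∧
      (∀ i, (ρ i).IsIrreducible) ∧
      (∀ i, (((ρ i).infl ((N i.castSucc).subgroupOf J)).res
        ((N i.succ).subgroupOf J)).IsIrreducible) ∧
      (∏ i : Fin l, SchurMultiplier.infl ((N i.castSucc).subgroupOf J) (d i) =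
        SchurMultiplier.res J c) ∧
      ∃ T : TwistedRep (SchurCocycle.res J α) (⨂[ℂ] i, Y i),
        T.SameProjective
          (TwistedRep.tensor fun i => (ρ i).infl ((N i.castSucc).subgroupOf J)) ∧
        φ.IsSimilar (TwistedRep.ind α J T) := by

  have := hφ.1
  obtain ⟨W, hW, hb, hprim⟩ := φ.toProjRep.exists_primitive_block
  set J := φ.toProjRep.stabilizer W with hJ
  obtain ⟨Y, hY1, hY2, e, he⟩ := hprim.exists_piTensor_equiv l (fun i => (N i).subgroupOf J)
    (fun i => inferInstance) (fun i j h => Subgroup.comap_mono (hmono h)) (by simp [htop]) W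
    (φ.toProjRep.subrep _ W le_rfl) (by
      simp only [hbot, Subgroup.bot_subgroupOf]
      exact ProjRep.scalarOn_bot _)
  have hYn : ∀ i, Nontrivial (Y i).carrier := fun i => (hY2 i).1
  choose γ σ hσ using fun i => (hY1 i).exists_infl
  have hsame := TwistedRep.SameProjective.of_piTensor_equiv
    (fun i => (σ i).infl ((N i.castSucc).subgroupOf J)) (fun i => (Y i).rep) (φ.subrep W) hσ e he
  have hres := fun i => (hY2 i).of_smul (hσ i)
  -- `T` is the action on `W` carried to the tensor product, so its cocycle is exactly the
  -- restriction of `α`; the diagonal action differs by scalars.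
  refine ⟨J, fun i => SchurCocycle.coclass (γ i), γ, fun i => (Y i).carrier, inferInstance,
    inferInstance, σ, fun i => rfl, inferInstance, fun i => ⟨hYn i, fun U hU => ?_⟩, hres, ?_,
    (φ.subrep W).transport e.symm, hsame, ?_⟩
  · exact (hres i).2 U fun g u hu => hU _ u hu
  · have := hprim.1
    have := e.toEquiv.nontrivial
    rw [← hα]
    simp only [SchurMultiplier.comap_coclass]
    rw [← SchurCocycle.coclass_prod]
    exact hsame.coclass_eq.symm
  · have hr : LinearMap.range (W.subtype ∘ₗ e.toLinearMap) = W := by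
      rw [LinearMap.range_comp, LinearEquiv.range, Submodule.map_subtype_top]
    refine φ.isSimilar_ind J _ (W.subtype ∘ₗ e.toLinearMap) ?_ hφ
      (W.subtype_injective.comp e.injective) (by rwa [hr]) (by rwa [hr]) (by rw [hr])
    intro h u
    change ((e (e.symm ((φ.subrep W).toFun h (e u))) : W) : V) = _
    rw [e.apply_symm_apply]
    rfl
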